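/- For a finite-dimensional complex Hilbert space $\mathcal H$, let $\mathcal L(\mathcal H)$ be the linear operators on $\mathcal H$ and let $\mathcal S(\mathcal H)$ be the set of strictly positive operators on $\mathcal H$ of trace $1$ (faithful density operators). For $\rho,\sigma\in\mathcal S(\mathcal H)$ and $\alpha\in\mathbb R\setminus\{0,1\}$ define the sandwiched Rényi $\alpha$-divergence $$D_\alpha(\rho\|\sigma)=\frac{1}{\alpha(\alpha-1)}\log\operatorname{Tr}\Bigl(\sigma^{\frac{1-\alpha}{2\alpha}}\rho\,\sigma^{\frac{1-\alpha}{2\alpha}}\Bigr)^{\alpha}$$ and the original sandwiched Rényi relative entropy $$\tilde D_\alpha(\rho\|\sigma)=\frac{1}{\alpha-1}\log\operatorname{Tr}\Bigl(\sigma^{\frac{1-\alpha}{2\alpha}}\rho\,\sigma^{\frac{1-\alpha}{2\alpha}}\Bigr)^{\alpha}-\frac{1}{\alpha-1}\log\operatorname{Tr}\rho .$$ Such a function $D$ is called monotone under CPTP maps if $D(\gamma(\rho)\|\gamma(\sigma))\le D(\rho\|\sigma)$ for all finite-dimensional complex Hilbert spaces $\mathcal H,\mathcal H'$, all completely positive trace-preserving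 linear maps $\gamma:\mathcal L(\mathcal H)\to\mathcal L(\mathcal H')$ and all $\rho,\sigma\in\mathcal S(\mathcal H)$ with $\gamma(\rho),\gamma(\sigma)\in\mathcal S(\mathcal H')$. Then $D_\alpha$ is not monotone under CPTP maps for any $\alpha\in(-1,0)\cup(0,\tfrac12)$. Consequently, $\tilde D_\alpha$ is not monotone under CPTP maps for any $\alpha\in(0,\tfrac12)$. -/

import Mathlib

open scoped CStarAlgebra

noncomputable section

/-- The trace of an operator on a finite-dimensional complex Hilbert space. -/
def opTrace {H : Type*} [NormedAddCommGroup H] [InnerProductSpace ℂ H]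
    (A : H →L[ℂ] H) : ℂ :=
  LinearMap.trace ℂ H (A : H →ₗ[ℂ] H)

/-- The quantum state space: strictly positive operators of trace one. -/
def StateSpace (H : Type*) [NormedAddCommGroup H] [InnerProductSpace ℂ H] [CompleteSpace H]
    [FiniteDimensional ℂ H] : Set (H →L[ℂ] H) :=
  {ρ | IsStrictlyPositive ρ ∧ opTrace ρ = 1}

/-- `Tr (σ^((1-α)/(2α)) ρ σ^((1-α)/(2α)))^α`, for `α ≠ 0`; real powers of a positive operator
are taken by functional calculus. The trace is real, and positive when `ρ` and `σ` are strictly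
positive and `H` is nontrivial. -/
def sandwichedTrace (α : ℝ) {H : Type*} [NormedAddCommGroup H] [InnerProductSpace ℂ H]
    [CompleteSpace H] [FiniteDimensional ℂ H] (ρ σ : H →L[ℂ] H) : ℝ :=
  (opTrace ((σ ^ ((1 - α) / (2 * α)) * ρ * σ ^ ((1 - α) / (2 * α))) ^ α)).re

/-- The sandwiched Rényi `α`-divergence `D_α(ρ‖σ)`, for `α ∉ {0, 1}` and `ρ`, `σ` in the
state space. -/
def sandwichedDivergence (α : ℝ) (H : Type*) [NormedAddCommGroup H] [InnerProductSpace ℂ H]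
    [CompleteSpace H] [FiniteDimensional ℂ H] (ρ σ : H →L[ℂ] H) : ℝ :=
  1 / (α * (α - 1)) * Real.log (sandwichedTrace α ρ σ)

/-- The original sandwiched Rényi relative entropy `D̃_α(ρ‖σ)`, for `α ∉ {0, 1}` and strictly
positive `ρ`, `σ` (where it is finite and needs no convention). -/
def sandwichedRelativeEntropy (α : ℝ) (H : Type*) [NormedAddCommGroup H]
    [InnerProductSpace ℂ H] [CompleteSpace H] [FiniteDimensional ℂ H]
    (ρ σ : H →L[ℂ] H) : ℝ :=
  1 / (α - 1) * Real.log (sandwichedTrace α ρ σ) - 1 / (α - 1) * Real.log (opTrace ρ).re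

/-- `Tr γ(A) = Tr A` for all `A`. The type `L(H) →CP L(H')` is Mathlib's type of completely
positive maps, so a CPTP map is an element of it with this property. -/
def IsTracePreserving {H H' : Type*} [NormedAddCommGroup H] [InnerProductSpace ℂ H]
    [CompleteSpace H] [NormedAddCommGroup H'] [InnerProductSpace ℂ H'] [CompleteSpace H']
    (γ : (H →L[ℂ] H) →CP (H' →L[ℂ] H')) : Prop :=
  ∀ A : H →L[ℂ] H, opTrace (γ A) = opTrace A

/-- A real function `D` of pairs of operators, given on every finite-dimensional complex Hilbert
space, is monotone under CPTP maps on the quantum state spaces if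
`D(γ(ρ)‖γ(σ)) ≤ D(ρ‖σ)` for all CPTP maps `γ : L(H) → L(H')` and all states `ρ, σ ∈ S(H)`
with `γ(ρ), γ(σ) ∈ S(H')`. -/
def MonotoneUnderCPTP
    (D : (H : Type) → [NormedAddCommGroup H] → [InnerProductSpace ℂ H] → [CompleteSpace H] →
      [FiniteDimensional ℂ H] → (H →L[ℂ] H) → (H →L[ℂ] H) → ℝ) : Prop :=
  ∀ (H H' : Type) [NormedAddCommGroup H] [InnerProductSpace ℂ H] [CompleteSpace H]
    [FiniteDimensional ℂ H] [NormedAddCommGroup H'] [InnerProductSpace ℂ H'] [CompleteSpace H']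
    [FiniteDimensional ℂ H'] (γ : (H →L[ℂ] H) →CP (H' →L[ℂ] H')), IsTracePreserving γ →
    ∀ ρ ∈ StateSpace H, ∀ σ ∈ StateSpace H, γ ρ ∈ StateSpace H' → γ σ ∈ StateSpace H' →
      D H' (γ ρ) (γ σ) ≤ D H ρ σ

end

/-!
# The sandwiched Rényi divergence is not monotone for small parameters

Write `Q α ρ σ` for the sandwiched trace. Monotonicity of the divergence says that `Q` does not
decrease under a channel when `0 < α < 1` and does not increase when `α < 0`. In each range an
explicit channel and an explicit pair of states violate this.

Traces of fractional powers are never computed. For `M ≥ 0`, `0 < b ≤ 1` and any orthonormal basis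
`e`, subadditivity and concavity of `x ↦ x ^ b` give
`(∑ i, ⟪e i, M (e i)⟫) ^ b ≤ Tr (M ^ b) ≤ ∑ i, ⟪e i, M (e i)⟫ ^ b`
(`sum_diag_rpow_le_opTrace_rpow`, `opTrace_rpow_le_sum_diag_rpow`). With `e` an eigenbasis of `σ`,
the diagonal entries of the sandwiched operator are elementary in the spectral data of `ρ` and `σ`;
for `α < 0` the bounds are applied to the inverse of that operator with exponent `-α`
(`sandwichedTrace_eq_rpow_neg`).

* For `0 < α < 1 / 2`, let `ρ` be close to a pure basis state and `σ` close to a pure state whose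
  squared overlap with it is `c < 1`, and pinch onto the basis. In the limit `Q` changes from `c ^ α`
  to `c ^ (1 - α)`, which is smaller because `α < 1 - α` (`eventually_pinching_lt`).
* For `-1 < α < 0`, put `b = -α` and `q = (1 + b) / b > 2`. Let the unit vector `ψ` be the direction
  in which `ρ` has a small eigenvalue `x`; then `Q` is asymptotically
  `x ^ (-b) * ⟪ψ, σ ^ q ψ⟫ ^ b`. Take `φ₁ = (3, 4) / 5`, `φ₂ = (3, -4) / 5` and `ψ = (4, 3) / 5`, so
  that `φ₂ ⟂ ψ`. The operator `|φ₁⟩⟨φ₁| / 2` on `ℂ²`, together with weight `1 / 2` in a third level,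
  is sent by a channel that moves the third level to `φ₂` to
  `(|φ₁⟩⟨φ₁| + |φ₂⟩⟨φ₂|) / 2 = diag (9, 16) / 25`. Although the added part is orthogonal to `ψ`, it
  increases `⟪ψ, σ ^ q ψ⟫`: the two values agree at `q = 2`, and for `q > 2` strict convexity of
  `y ↦ y ^ (q - 1)` separates them (`half_rpow_lt`).

Strictly positive states are obtained by a small perturbation, and the strict inequalities survive
by continuity.
-/

/-! ### Operators with a known orthonormal eigenbasis -/

section Eigenbasis

open scoped InnerProductSpace

variable {H : Type*} [NormedAddCommGroup H] [InnerProductSpace ℂ H] {ι : Type*} [Fintype ι]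

lemma opTrace_re_eq_sum_inner (T : H →L[ℂ] H) (e : OrthonormalBasis ι ℂ H) :
    (opTrace T).re = ∑ i, (⟪e i, T (e i)⟫_ℂ).re := by
  rw [opTrace, LinearMap.trace_eq_sum_inner _ e, Complex.re_sum]
  rfl

lemma opTrace_eq_of_eigenbasis {T : H →L[ℂ] H} {e : OrthonormalBasis ι ℂ H} {l : ι → ℝ}
    (h : ∀ i, T (e i) = (l i : ℂ) • e i) : opTrace T = ((∑ i, l i : ℝ) : ℂ) := by
  rw [opTrace, LinearMap.trace_eq_sum_inner _ e, Complex.ofReal_sum]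
  refine Finset.sum_congr rfl fun i _ => ?_
  rw [ContinuousLinearMap.coe_coe, h, inner_smul_right, inner_self_eq_norm_sq_to_K]
  simp

lemma inner_apply_of_eigenbasis {T : H →L[ℂ] H} {e : OrthonormalBasis ι ℂ H} {l : ι → ℝ}
    (h : ∀ i, T (e i) = (l i : ℂ) • e i) (x : H) :
    ⟪x, T x⟫_ℂ = ((∑ i, l i * ‖⟪e i, x⟫_ℂ‖ ^ 2 : ℝ) : ℂ) := by
  have hTx : T x = ∑ i, ((l i : ℂ) * ⟪e i, x⟫_ℂ) • e i := by
    conv_lhs => rw [← e.sum_repr' x]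
    rw [map_sum]
    exact Finset.sum_congr rfl fun i _ => by rw [map_smul, h, smul_smul, mul_comm]
  rw [hTx]
  rw [inner_sum, Complex.ofReal_sum]
  refine Finset.sum_congr rfl fun i _ => ?_
  rw [inner_smul_right, ← inner_conj_symm x (e i), mul_assoc, RCLike.mul_conj]
  push_cast
  rfl

lemma nonneg_of_eigenbasis {T : H →L[ℂ] H} {e : OrthonormalBasis ι ℂ H} {l : ι → ℝ}
    (h : ∀ i, T (e i) = (l i : ℂ) • e i) (hl : ∀ i, 0 ≤ l i) : 0 ≤ T := by
  rw [ContinuousLinearMap.nonneg_iff_isPositive, ContinuousLinearMap.isPositive_iff_complex]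
  intro x
  rw [← inner_conj_symm, inner_apply_of_eigenbasis h x]
  simp only [Complex.conj_ofReal, RCLike.re_to_complex, Complex.ofReal_re, true_and]
  exact Finset.sum_nonneg fun i _ => mul_nonneg (hl i) (by positivity)

lemma aeval_apply_of_eigenvector {T : H →L[ℂ] H} {v : H} {l : ℝ} (h : T v = (l : ℂ) • v)
    (p : Polynomial ℝ) : Polynomial.aeval T p v = ((p.eval l : ℝ) : ℂ) • v := by
  induction p using Polynomial.induction_on' with
  | add p q hp hq => simp [hp, hq, add_smul]
  | monomial n a =>
    have hn : (T ^ n) v = ((l : ℂ) ^ n) • v := by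
      induction n with
      | zero => simp
      | succ n ih => rw [pow_succ', mul_apply_eq_comp, ih, map_smul, h, smul_smul,
          pow_succ]
    rw [Polynomial.aeval_monomial, mul_apply_eq_comp, hn, Polynomial.eval_monomial,
      Algebra.algebraMap_eq_smul_one, smul_apply,
      one_apply_eq_self, Complex.ofReal_mul, Complex.ofReal_pow, mul_smul,
      Complex.coe_smul]

lemma finite_real_spectrum_of_finiteDimensional [FiniteDimensional ℂ H] (T : H →L[ℂ] H) :
    (spectrum ℝ T).Finite := by
  rw [← spectrum.preimage_algebraMap ℂ]
  refine Set.Finite.preimage (FaithfulSMul.algebraMap_injective ℝ ℂ).injOn ?_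
  have := AlgEquiv.spectrum_eq
    (Module.End.toContinuousLinearMap H : Module.End ℂ H ≃ₐ[ℂ] (H →L[ℂ] H)) (T : H →ₗ[ℂ] H)
  have h2 : (Module.End.toContinuousLinearMap H : Module.End ℂ H ≃ₐ[ℂ] (H →L[ℂ] H))
    (T : H →ₗ[ℂ] H) = T := by ext; rfl
  rw [h2] at this
  rw [this]
  exact Module.End.finite_spectrum _

lemma exists_eigenbasis_of_nonneg [FiniteDimensional ℂ H] {M : H →L[ℂ] H} (hM : 0 ≤ M) :
    ∃ (f : OrthonormalBasis (Fin (Module.finrank ℂ H)) ℂ H) (μ : Fin (Module.finrank ℂ H) → ℝ),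
      (∀ j, 0 ≤ μ j) ∧ ∀ j, M (f j) = (μ j : ℂ) • f j := by
  have hP := (ContinuousLinearMap.nonneg_iff_isPositive M).1 hM
  have hs : (M : H →ₗ[ℂ] H).IsSymmetric := hP.isSymmetric
  refine ⟨hs.eigenvectorBasis rfl, hs.eigenvalues rfl, fun j => ?_, hs.apply_eigenvectorBasis rfl⟩
  exact (M.isPositive_toLinearMap_iff.2 hP).nonneg_eigenvalues rfl j

variable [CompleteSpace H]

lemma isStrictlyPositive_of_eigenbasis {T : H →L[ℂ] H} {e : OrthonormalBasis ι ℂ H} {l : ι → ℝ}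
    (h : ∀ i, T (e i) = (l i : ℂ) • e i) (hl : ∀ i, 0 < l i) : IsStrictlyPositive T := by
  rw [IsStrictlyPositive.iff_of_unital]
  refine ⟨nonneg_of_eigenbasis h fun i => (hl i).le, ?_⟩
  have : FiniteDimensional ℂ H := e.toBasis.finiteDimensional_of_finite
  rw [ContinuousLinearMap.isUnit_iff_bijective]
  have hinj : Function.Injective (T : H →ₗ[ℂ] H) := by
    rw [injective_iff_map_eq_zero]
    intro x hx
    have h0 := inner_apply_of_eigenbasis h x
    have hx' : T x = 0 := hx
    rw [hx', inner_zero_right, eq_comm, Complex.ofReal_eq_zero,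
      Finset.sum_eq_zero_iff_of_nonneg fun i _ => mul_nonneg (hl i).le (by positivity)] at h0
    rw [← e.sum_repr' x]
    refine Finset.sum_eq_zero fun i hi => ?_
    have := h0 i hi
    rw [mul_eq_zero, or_iff_right (hl i).ne', sq_eq_zero_iff, norm_eq_zero] at this
    rw [this, zero_smul]
  exact ⟨hinj, LinearMap.surjective_of_injective hinj⟩

lemma mem_stateSpace_of_eigenbasis [FiniteDimensional ℂ H] {T : H →L[ℂ] H}
    {e : OrthonormalBasis ι ℂ H} {l : ι → ℝ} (h : ∀ i, T (e i) = (l i : ℂ) • e i)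
    (hl : ∀ i, 0 < l i) (hsum : ∑ i, l i = 1) : T ∈ StateSpace H :=
  ⟨isStrictlyPositive_of_eigenbasis h hl, by rw [opTrace_eq_of_eigenbasis h, hsum]; simp⟩

/-- The spectrum is finite, so on it any function agrees with an interpolating polynomial. -/
lemma cfc_apply_of_eigenvector [FiniteDimensional ℂ H] {T : H →L[ℂ] H} (hT : IsSelfAdjoint T)
    {v : H} {l : ℝ} (h : T v = (l : ℂ) • v) (f : ℝ → ℝ) :
    cfc f T v = ((f l : ℝ) : ℂ) • v := by
  classical
  set s : Finset ℝ := insert l (finite_real_spectrum_of_finiteDimensional T).toFinset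
  set p := Lagrange.interpolate s id f
  have hp : ∀ x ∈ s, p.eval x = f x := fun x hx =>
    Lagrange.eval_interpolate_at_node (v := id) f Function.injective_id.injOn hx
  have : cfc f T = cfc p.eval T := cfc_congr fun x hx => (hp x (by simp [s, hx])).symm
  rw [this, cfc_polynomial p T hT, aeval_apply_of_eigenvector h, hp l (by simp [s])]

lemma rpow_apply_of_eigenvector [FiniteDimensional ℂ H] {T : H →L[ℂ] H} (hT : 0 ≤ T)
    {v : H} {l : ℝ} (h : T v = (l : ℂ) • v) (y : ℝ) :
    (T ^ y) v = ((l ^ y : ℝ) : ℂ) • v := by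
  rw [CFC.rpow_eq_cfc_real hT, cfc_apply_of_eigenvector hT.isSelfAdjoint h]

/-- Concavity of `x ↦ x ^ b` makes the trace of `M ^ b` at most the sum of the `b`-th powers of the
diagonal entries of `M`, in every orthonormal basis. -/
lemma opTrace_rpow_le_sum_diag_rpow [FiniteDimensional ℂ H] {M : H →L[ℂ] H} (hM : 0 ≤ M)
    (e : OrthonormalBasis ι ℂ H) {b : ℝ} (hb : 0 ≤ b) (hb1 : b ≤ 1) :
    (opTrace (M ^ b)).re ≤ ∑ i, (⟪e i, M (e i)⟫_ℂ).re ^ b := by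
  obtain ⟨f, μ, hμ, hf⟩ := exists_eigenbasis_of_nonneg hM
  rw [opTrace_re_eq_sum_inner _ e]
  refine Finset.sum_le_sum fun i _ => ?_
  rw [inner_apply_of_eigenbasis hf, inner_apply_of_eigenbasis
    (fun j => rpow_apply_of_eigenvector hM (hf j) b), Complex.ofReal_re, Complex.ofReal_re]
  have := (Real.concaveOn_rpow hb hb1).le_map_sum (t := Finset.univ)
    (w := fun j => ‖⟪f j, e i⟫_ℂ‖ ^ 2) (p := μ) (fun j _ => by positivity)
    (by rw [f.sum_sq_norm_inner_right, e.norm_eq_one, one_pow]) (fun j _ => hμ j)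
  simpa only [smul_eq_mul, mul_comm] using this

lemma Real.rpow_sum_le_sum_rpow {κ : Type*} (s : Finset κ) {f : κ → ℝ} (hf : ∀ i ∈ s, 0 ≤ f i)
    {b : ℝ} (hb : 0 < b) (hb1 : b ≤ 1) : (∑ i ∈ s, f i) ^ b ≤ ∑ i ∈ s, f i ^ b := by
  classical
  induction s using Finset.induction_on with
  | empty => simp [Real.zero_rpow hb.ne']
  | insert a s ha ih =>
    rw [Finset.sum_insert ha, Finset.sum_insert ha]
    have hs : ∀ i ∈ s, 0 ≤ f i := fun i hi => hf i (Finset.mem_insert_of_mem hi)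
    exact (Real.rpow_add_le_add_rpow (hf a (Finset.mem_insert_self a s))
      (Finset.sum_nonneg hs) hb.le hb1).trans (by gcongr; exact ih hs)

/-- Subadditivity of `x ↦ x ^ b` on the eigenvalues bounds the trace of `M ^ b` from below. -/
lemma sum_diag_rpow_le_opTrace_rpow [FiniteDimensional ℂ H] {M : H →L[ℂ] H} (hM : 0 ≤ M)
    (e : OrthonormalBasis ι ℂ H) {b : ℝ} (hb : 0 < b) (hb1 : b ≤ 1) :
    (∑ i, (⟪e i, M (e i)⟫_ℂ).re) ^ b ≤ (opTrace (M ^ b)).re := by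
  obtain ⟨f, μ, hμ, hf⟩ := exists_eigenbasis_of_nonneg hM
  rw [← opTrace_re_eq_sum_inner _ e, opTrace_eq_of_eigenbasis hf, opTrace_eq_of_eigenbasis
    (fun j => rpow_apply_of_eigenvector hM (hf j) b), Complex.ofReal_re, Complex.ofReal_re]
  exact Real.rpow_sum_le_sum_rpow _ (fun j _ => hμ j) hb hb1

/-! ### The sandwiched trace of states with known eigenbases -/

variable {κ : Type*} [Fintype κ]

/-- The `i`-th diagonal entry of `σ ^ (t / 2) * ρ ^ v * σ ^ (t / 2)` in an eigenbasis `e` of `σ`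
with eigenvalues `l`, where `f` is an eigenbasis of `ρ` with eigenvalues `p`. -/
noncomputable def sandwichedDiag (t v : ℝ) (e : OrthonormalBasis ι ℂ H) (l : ι → ℝ)
    (f : OrthonormalBasis κ ℂ H) (p : κ → ℝ) (i : ι) : ℝ :=
  l i ^ t * ∑ j, p j ^ v * ‖⟪f j, e i⟫_ℂ‖ ^ 2

lemma re_inner_sandwich [FiniteDimensional ℂ H] {ρ σ : H →L[ℂ] H}
    {e : OrthonormalBasis ι ℂ H} {l : ι → ℝ} (hσ : ∀ i, σ (e i) = (l i : ℂ) • e i)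
    (hl : ∀ i, 0 < l i) {f : OrthonormalBasis κ ℂ H} {p : κ → ℝ}
    (hρ : ∀ j, ρ (f j) = (p j : ℂ) • f j) (hp : ∀ j, 0 < p j) (u v : ℝ) (i : ι) :
    (⟪e i, (σ ^ u * ρ ^ v * σ ^ u) (e i)⟫_ℂ).re = sandwichedDiag (2 * u) v e l f p i := by
  have hσ0 := nonneg_of_eigenbasis hσ fun i => (hl i).le
  have hρ0 := nonneg_of_eigenbasis hρ fun i => (hp i).le
  have hsa : IsSelfAdjoint (σ ^ u) := CFC.rpow_nonneg.isSelfAdjoint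
  rw [mul_apply_eq_comp, mul_apply_eq_comp,
    ← ContinuousLinearMap.adjoint_inner_left, ← ContinuousLinearMap.star_eq_adjoint,
    hsa.star_eq, rpow_apply_of_eigenvector hσ0 (hσ i), map_smul, inner_smul_left, inner_smul_right,
    inner_apply_of_eigenbasis (fun j => rpow_apply_of_eigenvector hρ0 (hρ j) v), sandwichedDiag,
    two_mul, Real.rpow_add (hl i), Complex.conj_ofReal, ← Complex.ofReal_mul, ← Complex.ofReal_mul,
    Complex.ofReal_re, mul_assoc]

lemma sandwich_nonneg [FiniteDimensional ℂ H] (ρ σ : H →L[ℂ] H) (u v : ℝ) :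
    0 ≤ σ ^ u * ρ ^ v * σ ^ u := by
  have hsa : IsSelfAdjoint (σ ^ u) := CFC.rpow_nonneg.isSelfAdjoint
  exact hsa.conjugate_nonneg CFC.rpow_nonneg

lemma sandwich_isStrictlyPositive [FiniteDimensional ℂ H] {ρ σ : H →L[ℂ] H}
    (hρ : IsStrictlyPositive ρ) (hσ : IsStrictlyPositive σ) (u v : ℝ) :
    IsStrictlyPositive (σ ^ u * ρ ^ v * σ ^ u) := by
  rw [IsStrictlyPositive.iff_of_unital]
  exact ⟨sandwich_nonneg _ _ _ _, ((hσ.isUnit.cfcRpow u hσ.nonneg).mul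
    (hρ.isUnit.cfcRpow v hρ.nonneg)).mul (hσ.isUnit.cfcRpow u hσ.nonneg)⟩

lemma sandwichedTrace_eq_rpow_one [FiniteDimensional ℂ H] (α : ℝ) {ρ : H →L[ℂ] H} (σ : H →L[ℂ] H)
    (hρ : IsStrictlyPositive ρ) : sandwichedTrace α ρ σ =
      (opTrace ((σ ^ ((1 - α) / (2 * α)) * ρ ^ (1 : ℝ) * σ ^ ((1 - α) / (2 * α))) ^ α)).re := by
  rw [sandwichedTrace, CFC.rpow_one ρ hρ.nonneg]

/-- Passing to the inverse operator replaces a negative power by a positive one. -/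
lemma sandwichedTrace_eq_rpow_neg [FiniteDimensional ℂ H] (α : ℝ) {ρ σ : H →L[ℂ] H}
    (hρ : IsStrictlyPositive ρ) (hσ : IsStrictlyPositive σ) : sandwichedTrace α ρ σ =
      (opTrace ((σ ^ (-((1 - α) / (2 * α))) * ρ ^ (-1 : ℝ) * σ ^ (-((1 - α) / (2 * α)))) ^
        (-α))).re := by
  rw [sandwichedTrace_eq_rpow_one α σ hρ]
  set u := (1 - α) / (2 * α)
  have hX := sandwich_isStrictlyPositive hρ hσ u 1
  have hinv : (σ ^ u * ρ ^ (1 : ℝ) * σ ^ u) ^ (-1 : ℝ) =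
      σ ^ (-u) * ρ ^ (-1 : ℝ) * σ ^ (-u) := by
    refine left_inv_eq_right_inv (a := σ ^ u * ρ ^ (1 : ℝ) * σ ^ u) ?_ ?_
    · have := CFC.rpow_neg_mul_rpow 1 hX
      rwa [CFC.rpow_one _ hX.nonneg] at this
    · calc σ ^ u * ρ ^ (1 : ℝ) * σ ^ u * (σ ^ (-u) * ρ ^ (-1 : ℝ) * σ ^ (-u))
          = σ ^ u * (ρ ^ (1 : ℝ) * (σ ^ u * σ ^ (-u)) * ρ ^ (-1 : ℝ)) * σ ^ (-u) := by
            simp only [mul_assoc]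
        _ = 1 := by
            rw [CFC.rpow_mul_rpow_neg u hσ, mul_one, CFC.rpow_mul_rpow_neg 1 hρ, mul_one,
              CFC.rpow_mul_rpow_neg u hσ]
  rw [← hinv, CFC.rpow_rpow _ _ _ (by norm_num) hX, neg_one_mul, neg_neg]

lemma sandwichedTrace_le_of_pos [FiniteDimensional ℂ H] {ρ σ : H →L[ℂ] H}
    {e : OrthonormalBasis ι ℂ H} {l : ι → ℝ} (hσ : ∀ i, σ (e i) = (l i : ℂ) • e i)
    (hl : ∀ i, 0 < l i) {f : OrthonormalBasis κ ℂ H} {p : κ → ℝ}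
    (hρ : ∀ j, ρ (f j) = (p j : ℂ) • f j) (hp : ∀ j, 0 < p j) {α : ℝ}
    (hα : 0 < α) (hα1 : α ≤ 1) :
    sandwichedTrace α ρ σ ≤ ∑ i, sandwichedDiag ((1 - α) / α) 1 e l f p i ^ α := by
  rw [sandwichedTrace_eq_rpow_one α σ (isStrictlyPositive_of_eigenbasis hρ hp)]
  refine (opTrace_rpow_le_sum_diag_rpow (sandwich_nonneg _ _ _ _) e hα.le hα1).trans_eq ?_
  simp_rw [re_inner_sandwich hσ hl hρ hp]
  congr! 3
  field_simp

lemma le_sandwichedTrace_of_pos [FiniteDimensional ℂ H] {ρ σ : H →L[ℂ] H}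
    {e : OrthonormalBasis ι ℂ H} {l : ι → ℝ} (hσ : ∀ i, σ (e i) = (l i : ℂ) • e i)
    (hl : ∀ i, 0 < l i) {f : OrthonormalBasis κ ℂ H} {p : κ → ℝ}
    (hρ : ∀ j, ρ (f j) = (p j : ℂ) • f j) (hp : ∀ j, 0 < p j) {α : ℝ}
    (hα : 0 < α) (hα1 : α ≤ 1) :
    (∑ i, sandwichedDiag ((1 - α) / α) 1 e l f p i) ^ α ≤ sandwichedTrace α ρ σ := by
  rw [sandwichedTrace_eq_rpow_one α σ (isStrictlyPositive_of_eigenbasis hρ hp)]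
  refine (sum_diag_rpow_le_opTrace_rpow (sandwich_nonneg _ _ _ _) e hα hα1).trans_eq' ?_
  simp_rw [re_inner_sandwich hσ hl hρ hp]
  congr! 3
  field_simp

lemma sandwichedTrace_le_of_neg [FiniteDimensional ℂ H] {ρ σ : H →L[ℂ] H}
    {e : OrthonormalBasis ι ℂ H} {l : ι → ℝ} (hσ : ∀ i, σ (e i) = (l i : ℂ) • e i)
    (hl : ∀ i, 0 < l i) {f : OrthonormalBasis κ ℂ H} {p : κ → ℝ}
    (hρ : ∀ j, ρ (f j) = (p j : ℂ) • f j) (hp : ∀ j, 0 < p j) {α : ℝ}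
    (hα : α < 0) (hα1 : -1 ≤ α) :
    sandwichedTrace α ρ σ ≤ ∑ i, sandwichedDiag (-((1 - α) / α)) (-1) e l f p i ^ (-α) := by
  rw [sandwichedTrace_eq_rpow_neg α (isStrictlyPositive_of_eigenbasis hρ hp)
    (isStrictlyPositive_of_eigenbasis hσ hl)]
  refine (opTrace_rpow_le_sum_diag_rpow (sandwich_nonneg _ _ _ _) e (by linarith)
    (by linarith)).trans_eq ?_
  simp_rw [re_inner_sandwich hσ hl hρ hp]
  congr! 3
  field_simp [hα.ne]

lemma le_sandwichedTrace_of_neg [FiniteDimensional ℂ H] {ρ σ : H →L[ℂ] H}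
    {e : OrthonormalBasis ι ℂ H} {l : ι → ℝ} (hσ : ∀ i, σ (e i) = (l i : ℂ) • e i)
    (hl : ∀ i, 0 < l i) {f : OrthonormalBasis κ ℂ H} {p : κ → ℝ}
    (hρ : ∀ j, ρ (f j) = (p j : ℂ) • f j) (hp : ∀ j, 0 < p j) {α : ℝ}
    (hα : α < 0) (hα1 : -1 ≤ α) :
    (∑ i, sandwichedDiag (-((1 - α) / α)) (-1) e l f p i) ^ (-α) ≤ sandwichedTrace α ρ σ := by
  rw [sandwichedTrace_eq_rpow_neg α (isStrictlyPositive_of_eigenbasis hρ hp)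
    (isStrictlyPositive_of_eigenbasis hσ hl)]
  refine (sum_diag_rpow_le_opTrace_rpow (sandwich_nonneg _ _ _ _) e (by linarith)
    (by linarith)).trans_eq' ?_
  simp_rw [re_inner_sandwich hσ hl hρ hp]
  congr! 3
  field_simp [hα.ne]

end Eigenbasis

/-! ### Completely positive maps in Kraus form -/

section Kraus

/-- If `γ (star a * b) = ∑ m, star (φ m a) * φ m b` for linear maps `φ m`, then `γ` is completely
positive: entrywise application of `γ` takes `star N * N` to `∑ m, star (φ m N) * φ m N`. -/
def CompletelyPositiveMap.ofStarMul {A₁ A₂ μ : Type*} [CStarAlgebra A₁] [CStarAlgebra A₂]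
    [PartialOrder A₁] [PartialOrder A₂] [StarOrderedRing A₁] [StarOrderedRing A₂] [Fintype μ]
    (γ : A₁ →ₗ[ℂ] A₂) (φ : μ → A₁ →ₗ[ℂ] A₂)
    (h : ∀ a b, γ (star a * b) = ∑ m, star (φ m a) * φ m b) : A₁ →CP A₂ where
  toLinearMap := γ
  map_cstarMatrix_nonneg' k M hM := by
    change 0 ≤ M.map γ
    induction StarOrderedRing.nonneg_iff.1 hM using AddSubmonoid.closure_induction with
    | mem X hX =>
      obtain ⟨N, rfl⟩ := hX
      have : (star N * N).map γ = ∑ m, star (N.map (φ m)) * N.map (φ m) := by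
        ext i j
        have hs : (∑ m, star (N.map (φ m)) * N.map (φ m)) i j =
            ∑ m, (star (N.map (φ m)) * N.map (φ m)) i j := Matrix.sum_apply i j _ _
        rw [hs]
        simp only [CStarMatrix.map_apply, CStarMatrix.mul_apply, CStarMatrix.star_apply, map_sum, h]
        exact Finset.sum_comm
      rw [this]
      exact Finset.sum_nonneg fun m _ => star_mul_self_nonneg _
    | zero =>
      have : (0 : CStarMatrix (Fin k) (Fin k) A₁).map γ = 0 := by ext i j; exact map_zero γ
      rw [this]
    | add X Y hX hY ihX ihY =>
      have : (X + Y).map γ = X.map γ + Y.map γ := by ext i j; exact map_add γ _ _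
      rw [this]
      exact add_nonneg (ihX (StarOrderedRing.nonneg_iff.2 hX))
        (ihY (StarOrderedRing.nonneg_iff.2 hY))

variable {H H' : Type*} [NormedAddCommGroup H] [InnerProductSpace ℂ H] [CompleteSpace H]
  [NormedAddCommGroup H'] [InnerProductSpace ℂ H'] [CompleteSpace H'] {μ : Type*} [Fintype μ]

open ContinuousLinearMap in
/-- The linear map `A ↦ ∑ k, (V k)† A (V k)`. -/
noncomputable def krausLinearMap (V : μ → H' →L[ℂ] H) : (H →L[ℂ] H) →ₗ[ℂ] (H' →L[ℂ] H') where
  toFun A := ∑ k, adjoint (V k) ∘L A ∘L V k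
  map_add' A B := by simp [ContinuousLinearMap.add_comp, ContinuousLinearMap.comp_add,
    Finset.sum_add_distrib]
  map_smul' c A := by simp [Finset.smul_sum]

open ContinuousLinearMap in
/-- The completely positive map with Kraus operators `(V k)†`. To exhibit complete positivity with
maps into `L(H')`, the products `A (V k) : H' → H` are cut into the rows `⟨b i| A (V k)` along an
orthonormal basis `b` of `H` and each row is placed on a fixed unit vector `u` of `H'`. -/
noncomputable def krausMap [FiniteDimensional ℂ H] (V : μ → H' →L[ℂ] H) (u : H') (hu : ‖u‖ = 1) :
    (H →L[ℂ] H) →CP (H' →L[ℂ] H') :=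
  let b := stdOrthonormalBasis ℂ H
  CompletelyPositiveMap.ofStarMul (krausLinearMap V)
    (fun m : μ × Fin (Module.finrank ℂ H) =>
      { toFun A := InnerProductSpace.rankOne ℂ u (b m.2) ∘L A ∘L V m.1
        map_add' A B := by simp [ContinuousLinearMap.add_comp, ContinuousLinearMap.comp_add]
        map_smul' c A := by simp })
    (fun A B => by
      rw [Fintype.sum_prod_type]
      refine Finset.sum_congr rfl fun k _ => ?_
      refine ContinuousLinearMap.ext fun x => ext_inner_left ℂ fun y => ?_
      simp only [LinearMap.coe_mk, AddHom.coe_mk, star_eq_adjoint, sum_apply,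
        mul_apply_eq_comp, ContinuousLinearMap.comp_apply, adjoint_inner_right,
        inner_sum, InnerProductSpace.rankOne_apply, inner_smul_left, inner_smul_right,
        inner_conj_symm, inner_self_eq_norm_sq_to_K, hu]
      rw [← b.sum_inner_mul_inner]
      refine Finset.sum_congr rfl fun i _ => ?_
      simp [mul_comm])

lemma krausMap_apply [FiniteDimensional ℂ H] (V : μ → H' →L[ℂ] H) (u : H') (hu : ‖u‖ = 1)
    (A : H →L[ℂ] H) :
    krausMap V u hu A = ∑ k, ContinuousLinearMap.adjoint (V k) ∘L A ∘L V k := rfl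

lemma isTracePreserving_krausMap [FiniteDimensional ℂ H] [FiniteDimensional ℂ H']
    (V : μ → H' →L[ℂ] H) (u : H') (hu : ‖u‖ = 1)
    (hV : ∑ k, V k ∘L ContinuousLinearMap.adjoint (V k) = ContinuousLinearMap.id ℂ H) :
    IsTracePreserving (krausMap V u hu) := by
  intro A
  have h1 : ∀ k, LinearMap.trace ℂ H'
      ((ContinuousLinearMap.adjoint (V k) ∘L A ∘L V k : H' →L[ℂ] H') : H' →ₗ[ℂ] H') =
      LinearMap.trace ℂ H
        ((A ∘L (V k ∘L ContinuousLinearMap.adjoint (V k)) : H →L[ℂ] H) : H →ₗ[ℂ] H) :=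
    fun k => LinearMap.trace_comp_comm' _ _
  rw [krausMap_apply, opTrace, ContinuousLinearMap.toLinearMap_sum, map_sum]
  simp_rw [h1]
  rw [← map_sum, ← ContinuousLinearMap.toLinearMap_sum, ← ContinuousLinearMap.comp_finsetSum, hV]
  rfl

end Kraus

/-! ### Operators given by real matrices -/

section RealMatrix

open scoped InnerProductSpace Matrix

variable {ι κ ν : Type*}

/-- A real vector, as an element of complex Euclidean space. -/
noncomputable def realVec (x : ι → ℝ) : EuclideanSpace ℂ ι := WithLp.toLp 2 fun i => (x i : ℂ)

lemma smul_realVec (c : ℝ) (x : ι → ℝ) : (c : ℂ) • realVec x = realVec (c • x) := by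
  ext i
  simp [realVec]

variable [Fintype ι]

lemma inner_realVec (x y : ι → ℝ) : ⟪realVec x, realVec y⟫_ℂ = ((x ⬝ᵥ y : ℝ) : ℂ) := by
  simp [realVec, PiLp.inner_apply, dotProduct, mul_comm]

variable [Fintype κ] [Fintype ν] [DecidableEq κ] [DecidableEq ν]

/-- The operator between complex Euclidean spaces with the given real matrix. -/
noncomputable def realOp (M : Matrix ι κ ℝ) : EuclideanSpace ℂ κ →L[ℂ] EuclideanSpace ℂ ι :=
  LinearMap.toContinuousLinearMap (Matrix.toEuclideanLin (M.map ((↑) : ℝ → ℂ)))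

lemma realOp_apply_realVec (M : Matrix ι κ ℝ) (x : κ → ℝ) :
    realOp M (realVec x) = realVec (M *ᵥ x) := by
  ext i
  simp [realOp, realVec, Matrix.mulVec, dotProduct]

lemma realOp_mul (M : Matrix ι κ ℝ) (N : Matrix κ ν ℝ) :
    realOp (M * N) = realOp M ∘L realOp N := by
  ext x i
  have : (M * N).map ((↑) : ℝ → ℂ) = M.map (↑) * N.map (↑) :=
    Matrix.map_mul (f := Complex.ofRealHom)
  simp only [realOp, this, LinearMap.coe_toContinuousLinearMap', ContinuousLinearMap.comp_apply,
    Matrix.toLpLin_apply, Matrix.mulVec_mulVec]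
  rfl

lemma realOp_sum {μ : Type*} [Fintype μ] (M : μ → Matrix ι κ ℝ) :
    realOp (∑ k, M k) = ∑ k, realOp (M k) := by
  have : (∑ k, M k).map ((↑) : ℝ → ℂ) = ∑ k, (M k).map (↑) := by
    ext i j
    simp [Matrix.sum_apply]
  simp [realOp, this]

variable [DecidableEq ι]

lemma realOp_one : realOp (1 : Matrix ι ι ℝ) = ContinuousLinearMap.id ℂ _ := by
  ext x i
  simp [realOp]

lemma adjoint_realOp (M : Matrix ι κ ℝ) : ContinuousLinearMap.adjoint (realOp M) = realOp Mᵀ := by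
  rw [eq_comm, ContinuousLinearMap.eq_adjoint_iff]
  intro x y
  simp only [realOp, LinearMap.coe_toContinuousLinearMap']
  have : Mᵀ.map ((↑) : ℝ → ℂ) = (M.map (↑))ᴴ := by
    ext i j
    simp
  rw [this, Matrix.toEuclideanLin_conjTranspose_eq_adjoint, LinearMap.adjoint_inner_left]

/-- The rows of a real orthogonal matrix, as an orthonormal basis of complex Euclidean space. -/
lemma exists_orthonormalBasis_rows {U : Matrix ι ι ℝ} (hU : U * Uᵀ = 1) :
    ∃ e : OrthonormalBasis ι ℂ (EuclideanSpace ℂ ι), ∀ i, e i = realVec (U i) := by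
  have ho : Orthonormal ℂ fun i => realVec (U i) := by
    rw [orthonormal_iff_ite]
    intro i j
    rw [inner_realVec]
    have := congrFun (congrFun hU i) j
    rw [Matrix.mul_apply, Matrix.one_apply] at this
    rw [dotProduct]
    simp only [Matrix.transpose_apply] at this
    rw [this]
    split_ifs <;> simp
  have hs : ⊤ ≤ Submodule.span ℂ (Set.range fun i => realVec (U i)) :=
    (ho.linearIndependent.span_eq_top_of_card_eq_finrank' (by simp)).ge
  exact ⟨OrthonormalBasis.mk ho hs, fun i => by rw [OrthonormalBasis.coe_mk]⟩

/-- The symmetric matrix with eigenvalues `l` on the rows of the orthogonal matrix `U`. -/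
def spectralMatrix (U : Matrix ι ι ℝ) (l : ι → ℝ) : Matrix ι ι ℝ := Uᵀ * Matrix.diagonal l * U

lemma realOp_spectralMatrix_apply {U : Matrix ι ι ℝ} (hU : U * Uᵀ = 1) (l : ι → ℝ) (i : ι) :
    realOp (spectralMatrix U l) (realVec (U i)) = (l i : ℂ) • realVec (U i) := by
  rw [realOp_apply_realVec, smul_realVec]
  congr 1
  have h1 : U i = Uᵀ *ᵥ Pi.single i 1 := by ext j; simp
  have h2 : U *ᵥ (U i) = Pi.single i 1 := by
    conv_lhs => rw [h1]
    rw [Matrix.mulVec_mulVec, hU, Matrix.one_mulVec]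
  rw [spectralMatrix, ← Matrix.mulVec_mulVec, h2, ← Matrix.mulVec_mulVec]
  ext j
  simp [mul_comm]

lemma realOp_spectralMatrix_mem_stateSpace {U : Matrix ι ι ℝ} (hU : U * Uᵀ = 1) {l : ι → ℝ}
    (hl : ∀ i, 0 < l i) (hsum : ∑ i, l i = 1) :
    realOp (spectralMatrix U l) ∈ StateSpace (EuclideanSpace ℂ ι) := by
  obtain ⟨e, he⟩ := exists_orthonormalBasis_rows hU
  refine mem_stateSpace_of_eigenbasis (e := e) (fun i => ?_) hl hsum
  rw [he, realOp_spectralMatrix_apply hU]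

lemma krausMap_realOp {μ : Type*} [Fintype μ] (K : μ → Matrix κ ι ℝ) (u : EuclideanSpace ℂ ι)
    (hu : ‖u‖ = 1) (M : Matrix κ κ ℝ) :
    krausMap (fun k => realOp (K k)) u hu (realOp M) = realOp (∑ k, (K k)ᵀ * M * K k) := by
  rw [krausMap_apply, realOp_sum]
  refine Finset.sum_congr rfl fun k _ => ?_
  rw [adjoint_realOp, realOp_mul, realOp_mul, ContinuousLinearMap.comp_assoc]

lemma isTracePreserving_krausMap_realOp {μ : Type*} [Fintype μ] {K : μ → Matrix κ ι ℝ}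
    (u : EuclideanSpace ℂ ι) (hu : ‖u‖ = 1) (hK : ∑ k, K k * (K k)ᵀ = 1) :
    IsTracePreserving (krausMap (fun k => realOp (K k)) u hu) := by
  refine isTracePreserving_krausMap _ u hu ?_
  simp_rw [adjoint_realOp, ← realOp_mul]
  rw [← realOp_sum, hK, realOp_one]

/-- The matrix form of `sandwichedDiag`, for eigenbases given by the rows of `U` and `W`. -/
noncomputable def realDiag (t v : ℝ) (U : Matrix ι ι ℝ) (l : ι → ℝ) (W : Matrix ι ι ℝ)
    (p : ι → ℝ) (i : ι) : ℝ :=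
  l i ^ t * ∑ j, p j ^ v * (W j ⬝ᵥ U i) ^ 2

lemma sandwichedTrace_realOp_mem_Icc_of_pos {U W : Matrix ι ι ℝ} (hU : U * Uᵀ = 1)
    (hW : W * Wᵀ = 1) {l p : ι → ℝ} (hl : ∀ i, 0 < l i) (hp : ∀ i, 0 < p i) {α : ℝ}
    (hα : 0 < α) (hα1 : α ≤ 1) :
    sandwichedTrace α (realOp (spectralMatrix W p)) (realOp (spectralMatrix U l)) ∈
      Set.Icc ((∑ i, realDiag ((1 - α) / α) 1 U l W p i) ^ α)
        (∑ i, realDiag ((1 - α) / α) 1 U l W p i ^ α) := by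
  obtain ⟨e, he⟩ := exists_orthonormalBasis_rows hU
  obtain ⟨f, hf⟩ := exists_orthonormalBasis_rows hW
  have h1 : ∀ i, realOp (spectralMatrix U l) (e i) = (l i : ℂ) • e i := fun i => by
    rw [he, realOp_spectralMatrix_apply hU]
  have h2 : ∀ i, realOp (spectralMatrix W p) (f i) = (p i : ℂ) • f i := fun i => by
    rw [hf, realOp_spectralMatrix_apply hW]
  have h3 : ∀ i, sandwichedDiag ((1 - α) / α) 1 e l f p i =
      realDiag ((1 - α) / α) 1 U l W p i := fun i => by
    simp [sandwichedDiag, realDiag, he, hf, inner_realVec]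
  simp_rw [← h3]
  exact ⟨le_sandwichedTrace_of_pos h1 hl h2 hp hα hα1,
    sandwichedTrace_le_of_pos h1 hl h2 hp hα hα1⟩

lemma sandwichedTrace_realOp_mem_Icc_of_neg {U W : Matrix ι ι ℝ} (hU : U * Uᵀ = 1)
    (hW : W * Wᵀ = 1) {l p : ι → ℝ} (hl : ∀ i, 0 < l i) (hp : ∀ i, 0 < p i) {α : ℝ}
    (hα : α < 0) (hα1 : -1 ≤ α) :
    sandwichedTrace α (realOp (spectralMatrix W p)) (realOp (spectralMatrix U l)) ∈
      Set.Icc ((∑ i, realDiag (-((1 - α) / α)) (-1) U l W p i) ^ (-α))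
        (∑ i, realDiag (-((1 - α) / α)) (-1) U l W p i ^ (-α)) := by
  obtain ⟨e, he⟩ := exists_orthonormalBasis_rows hU
  obtain ⟨f, hf⟩ := exists_orthonormalBasis_rows hW
  have h1 : ∀ i, realOp (spectralMatrix U l) (e i) = (l i : ℂ) • e i := fun i => by
    rw [he, realOp_spectralMatrix_apply hU]
  have h2 : ∀ i, realOp (spectralMatrix W p) (f i) = (p i : ℂ) • f i := fun i => by
    rw [hf, realOp_spectralMatrix_apply hW]
  have h3 : ∀ i, sandwichedDiag (-((1 - α) / α)) (-1) e l f p i =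
      realDiag (-((1 - α) / α)) (-1) U l W p i := fun i => by
    simp [sandwichedDiag, realDiag, he, hf, inner_realVec]
  simp_rw [← h3]
  exact ⟨le_sandwichedTrace_of_neg h1 hl h2 hp hα hα1,
    sandwichedTrace_le_of_neg h1 hl h2 hp hα hα1⟩

end RealMatrix

/-! ### From the sandwiched trace to the divergences -/

section Divergence

lemma opTrace_re_pos {H : Type*} [NormedAddCommGroup H] [InnerProductSpace ℂ H] [CompleteSpace H]
    [FiniteDimensional ℂ H] [Nontrivial H] {X : H →L[ℂ] H} (hX : IsStrictlyPositive X) :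
    0 < (opTrace X).re := by
  obtain ⟨f, μ, hμ, hf⟩ := exists_eigenbasis_of_nonneg hX.nonneg
  rw [opTrace_eq_of_eigenbasis hf, Complex.ofReal_re]
  refine (Finset.sum_nonneg fun j _ => hμ j).lt_of_ne fun h0 => hX.isUnit.ne_zero ?_
  rw [eq_comm, Finset.sum_eq_zero_iff_of_nonneg fun j _ => hμ j] at h0
  ext x
  rw [← f.sum_repr' x, map_sum]
  exact Finset.sum_eq_zero fun j hj => by rw [map_smul, hf, h0 j hj]; simp

lemma sandwichedTrace_pos (α : ℝ) {H : Type*} [NormedAddCommGroup H] [InnerProductSpace ℂ H]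
    [CompleteSpace H] [FiniteDimensional ℂ H] [Nontrivial H] {ρ σ : H →L[ℂ] H}
    (hρ : ρ ∈ StateSpace H) (hσ : σ ∈ StateSpace H) : 0 < sandwichedTrace α ρ σ := by
  rw [sandwichedTrace_eq_rpow_one α σ hρ.1]
  have hX := sandwich_isStrictlyPositive hρ.1 hσ.1 ((1 - α) / (2 * α)) 1
  refine opTrace_re_pos ?_
  rw [IsStrictlyPositive.iff_of_unital]
  exact ⟨CFC.rpow_nonneg, hX.isUnit.cfcRpow α hX.nonneg⟩

lemma nontrivial_of_mem_stateSpace {H : Type*} [NormedAddCommGroup H] [InnerProductSpace ℂ H]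
    [CompleteSpace H] [FiniteDimensional ℂ H] {ρ : H →L[ℂ] H} (hρ : ρ ∈ StateSpace H) :
    Nontrivial H := by
  by_contra hn
  rw [not_nontrivial_iff_subsingleton] at hn
  have h0 : ρ = 0 := Subsingleton.elim _ _
  simpa [h0, opTrace] using hρ.2

/-- On states the two divergences differ by the factor `α`. -/
lemma MonotoneUnderCPTP.of_sandwichedRelativeEntropy {α : ℝ} (hα : 0 < α)
    (h : MonotoneUnderCPTP (sandwichedRelativeEntropy α)) :
    MonotoneUnderCPTP (sandwichedDivergence α) := by
  have key : ∀ {H : Type} [NormedAddCommGroup H] [InnerProductSpace ℂ H] [CompleteSpace H]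
      [FiniteDimensional ℂ H] {ρ : H →L[ℂ] H} (σ : H →L[ℂ] H), ρ ∈ StateSpace H →
      sandwichedRelativeEntropy α H ρ σ = α * sandwichedDivergence α H ρ σ := by
    intro H _ _ _ _ ρ σ hρ
    rw [sandwichedRelativeEntropy, sandwichedDivergence, hρ.2, Complex.one_re, Real.log_one,
      mul_zero, sub_zero, ← mul_assoc]
    congr 1
    rw [one_div, one_div, mul_inv, ← mul_assoc, mul_inv_cancel₀ hα.ne', one_mul]
  intro H H' _ _ _ _ _ _ _ _ γ hγ ρ hρ σ hσ hρ' hσ'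
  have := h H H' γ hγ ρ hρ σ hσ hρ' hσ'
  rw [key _ hρ, key _ hρ'] at this
  exact le_of_mul_le_mul_left this hα

variable {H H' : Type} [NormedAddCommGroup H] [InnerProductSpace ℂ H] [CompleteSpace H]
  [FiniteDimensional ℂ H] [NormedAddCommGroup H'] [InnerProductSpace ℂ H'] [CompleteSpace H']
  [FiniteDimensional ℂ H']

lemma MonotoneUnderCPTP.sandwichedTrace_le_of_pos {α : ℝ} (hα : 0 < α) (hα1 : α < 1)
    (h : MonotoneUnderCPTP (sandwichedDivergence α)) {γ : (H →L[ℂ] H) →CP (H' →L[ℂ] H')}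
    (hγ : IsTracePreserving γ) {ρ σ : H →L[ℂ] H} (hρ : ρ ∈ StateSpace H) (hσ : σ ∈ StateSpace H)
    (hρ' : γ ρ ∈ StateSpace H') (hσ' : γ σ ∈ StateSpace H') :
    sandwichedTrace α ρ σ ≤ sandwichedTrace α (γ ρ) (γ σ) := by
  have : Nontrivial H := nontrivial_of_mem_stateSpace hρ
  have : Nontrivial H' := nontrivial_of_mem_stateSpace hρ'
  have h1 := h H H' γ hγ ρ hρ σ hσ hρ' hσ'
  have hc : 1 / (α * (α - 1)) < 0 := one_div_neg.2 (mul_neg_of_pos_of_neg hα (by linarith))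
  rw [sandwichedDivergence, sandwichedDivergence, mul_le_mul_left_of_neg hc] at h1
  exact (Real.log_le_log_iff (sandwichedTrace_pos α hρ hσ) (sandwichedTrace_pos α hρ' hσ')).1 h1

lemma MonotoneUnderCPTP.sandwichedTrace_le_of_neg {α : ℝ} (hα : α < 0)
    (h : MonotoneUnderCPTP (sandwichedDivergence α)) {γ : (H →L[ℂ] H) →CP (H' →L[ℂ] H')}
    (hγ : IsTracePreserving γ) {ρ σ : H →L[ℂ] H} (hρ : ρ ∈ StateSpace H) (hσ : σ ∈ StateSpace H)
    (hρ' : γ ρ ∈ StateSpace H') (hσ' : γ σ ∈ StateSpace H') :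
    sandwichedTrace α (γ ρ) (γ σ) ≤ sandwichedTrace α ρ σ := by
  have : Nontrivial H := nontrivial_of_mem_stateSpace hρ
  have : Nontrivial H' := nontrivial_of_mem_stateSpace hρ'
  have h1 := h H H' γ hγ ρ hρ σ hσ hρ' hσ'
  have hc : 0 < 1 / (α * (α - 1)) := one_div_pos.2 (mul_pos_of_neg_of_neg hα (by linarith))
  rw [sandwichedDivergence, sandwichedDivergence, mul_le_mul_iff_right₀ hc] at h1
  exact (Real.log_le_log_iff (sandwichedTrace_pos α hρ' hσ') (sandwichedTrace_pos α hρ hσ)).1 h1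

end Divergence

/-! ### Parameters between `0` and `1 / 2` -/

section Pinching

open Filter Topology
open scoped Matrix

/-- The bound for `Q` after pinching lies below the bound before it: at `x = 0` the claim reads
`((9 / 25) ^ t) ^ α < (9 / 25) ^ α`, and both sides are continuous in the perturbation `x`. -/
lemma eventually_pinching_lt {α t : ℝ} (hα : 0 < α) (ht : 1 < t) : ∀ᶠ x : ℝ in 𝓝[>] 0,
    (((9 + 7 * x) / 25) ^ t * (1 - x)) ^ α + (((16 - 7 * x) / 25) ^ t * x) ^ α <
      ((1 - x) ^ t * ((1 - x) * (9 / 25) + x * (16 / 25)) +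
        x ^ t * ((1 - x) * (16 / 25) + x * (9 / 25))) ^ α := by
  have ht0 : 0 ≤ t := by linarith
  have hα0 : 0 ≤ α := hα.le
  have hc1 : Continuous fun x : ℝ =>
      (((9 + 7 * x) / 25) ^ t * (1 - x)) ^ α + (((16 - 7 * x) / 25) ^ t * x) ^ α := by
    fun_prop (disch := assumption)
  have hc2 : Continuous fun x : ℝ => ((1 - x) ^ t * ((1 - x) * (9 / 25) + x * (16 / 25)) +
        x ^ t * ((1 - x) * (16 / 25) + x * (9 / 25))) ^ α := by
    fun_prop (disch := assumption)
  refine Filter.Eventually.filter_mono nhdsWithin_le_nhds ?_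
  refine hc1.continuousAt.eventually_lt hc2.continuousAt ?_
  have h : ((9 : ℝ) / 25) ^ t < 9 / 25 := by
    simpa using Real.rpow_lt_rpow_of_exponent_gt (x := (9 : ℝ) / 25) (by norm_num) (by norm_num) ht
  have := Real.rpow_lt_rpow (by positivity) h hα
  simpa [Real.zero_rpow hα.ne', Real.zero_rpow (by linarith : t ≠ 0)] using this

/-- The states are `ρ = diag (1 - x, x)` and `σ` with the same eigenvalues on the basis
`(3, 4) / 5`, `(4, -3) / 5`; the channel deletes the off-diagonal entries. -/
theorem not_monotoneUnderCPTP_of_pos {α : ℝ} (hα : 0 < α) (hα1 : α < 1 / 2) :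
    ¬ MonotoneUnderCPTP (sandwichedDivergence α) := by
  intro h
  have ht : 1 < (1 - α) / α := by rw [lt_div_iff₀ hα]; linarith
  obtain ⟨x, hlt, hx0, hx1⟩ := ((eventually_pinching_lt hα ht).and
    (Ioo_mem_nhdsGT one_pos)).exists
  obtain ⟨R, hR⟩ : ∃ M : Matrix (Fin 2) (Fin 2) ℝ, M = !![3 / 5, 4 / 5; 4 / 5, -3 / 5] := ⟨_, rfl⟩
  obtain ⟨K, hK⟩ : ∃ M : Fin 2 → Matrix (Fin 2) (Fin 2) ℝ,
      M = ![!![1, 0; 0, 0], !![0, 0; 0, 1]] := ⟨_, rfl⟩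
  obtain ⟨p, hp⟩ : ∃ M : Fin 2 → ℝ, M = ![1 - x, x] := ⟨_, rfl⟩
  obtain ⟨l, hl⟩ : ∃ M : Fin 2 → ℝ, M = ![(9 + 7 * x) / 25, (16 - 7 * x) / 25] := ⟨_, rfl⟩
  have hRR : R * Rᵀ = 1 := by
    ext i j; fin_cases i <;> fin_cases j <;>
      simp [hR, Matrix.mul_apply, Fin.sum_univ_two] <;> norm_num
  have h11 : (1 : Matrix (Fin 2) (Fin 2) ℝ) * 1ᵀ = 1 := by simp
  have hKK : ∑ k, K k * (K k)ᵀ = 1 := by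
    ext i j; fin_cases i <;> fin_cases j <;>
      simp [hK, Matrix.vecMul, dotProduct, Fin.sum_univ_two, Matrix.add_apply]
  have hp0 : ∀ i, 0 < p i := by
    intro i; fin_cases i <;> simp [hp] <;> linarith
  have hl0 : ∀ i, 0 < l i := by
    intro i; fin_cases i <;> simp [hl] <;> linarith
  have hps : ∑ i, p i = 1 := by simp [hp, Fin.sum_univ_two]
  have hls : ∑ i, l i = 1 := by simp [hl, Fin.sum_univ_two]; ring
  have hρ : ∑ k, (K k)ᵀ * spectralMatrix 1 p * K k = spectralMatrix 1 p := by
    ext i j; fin_cases i <;> fin_cases j <;>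
      simp [hK, hp, spectralMatrix, Matrix.mul_apply, Fin.sum_univ_two, Matrix.add_apply,
        Matrix.diagonal_apply]
  have hσ : ∑ k, (K k)ᵀ * spectralMatrix R p * K k = spectralMatrix 1 l := by
    ext i j; fin_cases i <;> fin_cases j <;>
      simp [hK, hp, hl, hR, spectralMatrix, Matrix.mul_apply, Fin.sum_univ_two, Matrix.add_apply,
        Matrix.diagonal_apply] <;> ring
  set u : EuclideanSpace ℂ (Fin 2) := EuclideanSpace.single 0 1
  have hu : ‖u‖ = 1 := by simp [u]
  have hle := h.sandwichedTrace_le_of_pos hα (by linarith)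
    (isTracePreserving_krausMap_realOp u hu hKK)
    (realOp_spectralMatrix_mem_stateSpace h11 hp0 hps)
    (realOp_spectralMatrix_mem_stateSpace hRR hp0 hps)
    (by rw [krausMap_realOp, hρ]; exact realOp_spectralMatrix_mem_stateSpace h11 hp0 hps)
    (by rw [krausMap_realOp, hσ]; exact realOp_spectralMatrix_mem_stateSpace h11 hl0 hls)
  rw [krausMap_realOp, krausMap_realOp, hρ, hσ] at hle
  have hin := (sandwichedTrace_realOp_mem_Icc_of_pos hRR h11 hp0 hp0 hα (by linarith)).1
  have hout := (sandwichedTrace_realOp_mem_Icc_of_pos h11 h11 hl0 hp0 hα (by linarith)).2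
  have := (hin.trans hle).trans hout
  refine absurd this (not_le.2 ?_)
  refine (Eq.trans_lt ?_ hlt).trans_eq ?_
  · simp [realDiag, Fin.sum_univ_two, hp, hl, Matrix.one_apply, dotProduct]
  · congr 1
    simp [realDiag, Fin.sum_univ_two, hp, hR, Matrix.one_apply, dotProduct]
    ring

end Pinching

/-! ### Parameters between `-1` and `0` -/

section Negative

open Filter Topology
open scoped Matrix

/-- With `ψ = (4, 3) / 5` and `φ₁ = (3, 4) / 5`, this is
`⟪ψ, (|φ₁⟩⟨φ₁| / 2) ^ q ψ⟫ < ⟪ψ, (diag (9, 16) / 25) ^ q ψ⟫`. Cancelling `144 / 625`, it is midpoint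
strict convexity of `y ↦ y ^ (q - 1)` at `9 / 25` and `16 / 25`. -/
lemma half_rpow_lt {q : ℝ} (hq : 2 < q) :
    (1 / 2 : ℝ) ^ q * (24 / 25) ^ 2 < (9 / 25) ^ q * (16 / 25) + (16 / 25) ^ q * (9 / 25) := by
  have h := (strictConvexOn_rpow (by linarith : 1 < q - 1)).2
    (show (9 / 25 : ℝ) ∈ Set.Ici 0 by norm_num) (show (16 / 25 : ℝ) ∈ Set.Ici 0 by norm_num)
    (by norm_num) (show (0 : ℝ) < 1 / 2 by norm_num) (show (0 : ℝ) < 1 / 2 by norm_num)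
    (by norm_num)
  have hs : ∀ y : ℝ, 0 < y → y ^ q = y ^ (q - 1) * y := fun y hy => by
    rw [← Real.rpow_add_one hy.ne', sub_add_cancel]
  rw [hs _ (by norm_num : (0 : ℝ) < 1 / 2), hs _ (by norm_num : (0 : ℝ) < 9 / 25),
    hs _ (by norm_num : (0 : ℝ) < 16 / 25)]
  have h3 : (1 / 2 : ℝ) • (9 / 25 : ℝ) + (1 / 2 : ℝ) • (16 / 25 : ℝ) = 1 / 2 := by norm_num
  simp only [h3] at h
  simp only [smul_eq_mul] at h
  linarith

/-- The bounds for `Q` before and after the channel, both multiplied by `x ^ b`. At `x = 0` the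
second and third summands on the left vanish and the claim is `half_rpow_lt`. -/
lemma eventually_rescaled_lt {b q : ℝ} (hb : 0 < b) (hq : 2 < q) : ∀ᶠ x : ℝ in 𝓝[>] 0,
    ((1 / 2) ^ q * ((24 / 25) ^ 2 + x * (2 / (1 - x) * (7 / 25) ^ 2))) ^ b +
      ((x / 2) ^ q * ((7 / 25) ^ 2 + x * (2 / (1 - x) * (24 / 25) ^ 2))) ^ b +
      (((1 - x) / 2) ^ q * (x * (2 / (1 - x)))) ^ b <
    (((1 - x) * (9 / 25) + x / 2) ^ q * (16 / 25 + x * (1 / (1 - x) * (9 / 25))) +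
      ((1 - x) * (16 / 25) + x / 2) ^ q * (9 / 25 + x * (1 / (1 - x) * (16 / 25)))) ^ b := by
  have hq0 : 0 ≤ q := by linarith
  have hb0 : 0 ≤ b := hb.le
  have hc1 : ContinuousAt (fun x : ℝ =>
      ((1 / 2) ^ q * ((24 / 25) ^ 2 + x * (2 / (1 - x) * (7 / 25) ^ 2))) ^ b +
      ((x / 2) ^ q * ((7 / 25) ^ 2 + x * (2 / (1 - x) * (24 / 25) ^ 2))) ^ b +
      (((1 - x) / 2) ^ q * (x * (2 / (1 - x)))) ^ b) 0 := by
    fun_prop (disch := first | assumption | norm_num)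
  have hc2 : ContinuousAt (fun x : ℝ =>
      (((1 - x) * (9 / 25) + x / 2) ^ q * (16 / 25 + x * (1 / (1 - x) * (9 / 25))) +
      ((1 - x) * (16 / 25) + x / 2) ^ q * (9 / 25 + x * (1 / (1 - x) * (16 / 25)))) ^ b) 0 := by
    fun_prop (disch := first | assumption | norm_num)
  refine Filter.Eventually.filter_mono nhdsWithin_le_nhds ?_
  refine hc1.eventually_lt hc2 ?_
  have := Real.rpow_lt_rpow (by positivity) (half_rpow_lt hq) hb
  simpa [Real.zero_rpow hb.ne', Real.zero_rpow (by linarith : q ≠ 0)] using this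

/-- On `ℂ³`, the rows of `U` and `l` diagonalize `σ`, those of `W` and `p` diagonalize `ρ`, both
block diagonal for `ℂ² ⊕ ℂ`. The channel with Kraus operators `(K k)ᵀ` keeps the block on `ℂ²` and
prepares `(3, -4) / 5` from the third level. -/
theorem not_monotoneUnderCPTP_of_neg {α : ℝ} (hα1 : -1 < α) (hα : α < 0) :
    ¬ MonotoneUnderCPTP (sandwichedDivergence α) := by
  intro h
  have hb : 0 < -α := by linarith
  have hq : 2 < -((1 - α) / α) := by
    rw [← div_neg, lt_div_iff₀ hb]; linarith
  obtain ⟨x, hlt, hx0, hx1⟩ := ((eventually_rescaled_lt hb hq).and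
    (Ioo_mem_nhdsGT one_pos)).exists
  obtain ⟨U, hU⟩ : ∃ M : Matrix (Fin 3) (Fin 3) ℝ,
      M = !![3 / 5, 4 / 5, 0; 4 / 5, -3 / 5, 0; 0, 0, 1] := ⟨_, rfl⟩
  obtain ⟨W, hW⟩ : ∃ M : Matrix (Fin 3) (Fin 3) ℝ,
      M = !![4 / 5, 3 / 5, 0; 3 / 5, -4 / 5, 0; 0, 0, 1] := ⟨_, rfl⟩
  obtain ⟨W', hW'⟩ : ∃ M : Matrix (Fin 2) (Fin 2) ℝ, M = !![4 / 5, 3 / 5; 3 / 5, -4 / 5] := ⟨_, rfl⟩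
  obtain ⟨K, hK⟩ : ∃ M : Fin 2 → Matrix (Fin 3) (Fin 2) ℝ, M =
    ![!![1, 0; 0, 1; 0, 0], !![0, 0; 0, 0; 3 / 5, -4 / 5]] := ⟨_, rfl⟩
  -- The term `x / 2` mixes `σ` with a multiple of the identity of the block on `ℂ²`, which keeps
  -- the eigenvectors before and after the channel.
  obtain ⟨l, hl⟩ : ∃ M : Fin 3 → ℝ, M = ![1 / 2, x / 2, (1 - x) / 2] := ⟨_, rfl⟩
  obtain ⟨p, hp⟩ : ∃ M : Fin 3 → ℝ, M = ![x, (1 - x) / 2, (1 - x) / 2] := ⟨_, rfl⟩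
  obtain ⟨l', hl'⟩ : ∃ M : Fin 2 → ℝ,
      M = ![(1 - x) * (9 / 25) + x / 2, (1 - x) * (16 / 25) + x / 2] := ⟨_, rfl⟩
  obtain ⟨p', hp'⟩ : ∃ M : Fin 2 → ℝ, M = ![x, 1 - x] := ⟨_, rfl⟩
  have hUU : U * Uᵀ = 1 := by
    ext i j; fin_cases i <;> fin_cases j <;>
      simp [hU, Matrix.mul_apply, Fin.sum_univ_three] <;> norm_num
  have hWW : W * Wᵀ = 1 := by
    ext i j; fin_cases i <;> fin_cases j <;>
      simp [hW, Matrix.mul_apply, Fin.sum_univ_three] <;> norm_num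
  have hWW' : W' * W'ᵀ = 1 := by
    ext i j; fin_cases i <;> fin_cases j <;>
      simp [hW', Matrix.mul_apply, Fin.sum_univ_two] <;> norm_num
  have h11 : (1 : Matrix (Fin 2) (Fin 2) ℝ) * 1ᵀ = 1 := by simp
  have hKK : ∑ k, K k * (K k)ᵀ = 1 := by
    ext i j; fin_cases i <;> fin_cases j <;>
      simp [hK, Matrix.vecMul, dotProduct, Fin.sum_univ_two, Matrix.add_apply]
    norm_num
  have hp0 : ∀ i, 0 < p i := by
    intro i; fin_cases i <;> simp [hp] <;> linarith
  have hl0 : ∀ i, 0 < l i := by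
    intro i; fin_cases i <;> simp [hl] <;> linarith
  have hp0' : ∀ i, 0 < p' i := by
    intro i; fin_cases i <;> simp [hp'] <;> linarith
  have hl0' : ∀ i, 0 < l' i := by
    intro i; fin_cases i <;> simp [hl'] <;> linarith
  have hps : ∑ i, p i = 1 := by simp [hp, Fin.sum_univ_three]; ring
  have hls : ∑ i, l i = 1 := by simp [hl, Fin.sum_univ_three]; ring
  have hps' : ∑ i, p' i = 1 := by simp [hp', Fin.sum_univ_two]
  have hls' : ∑ i, l' i = 1 := by simp [hl', Fin.sum_univ_two]; ring
  have hρ : ∑ k, (K k)ᵀ * spectralMatrix W p * K k = spectralMatrix W' p' := by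
    ext i j; fin_cases i <;> fin_cases j <;>
      simp [hK, hp, hp', hW, hW', spectralMatrix, Matrix.mul_apply, Fin.sum_univ_two,
        Fin.sum_univ_three, Matrix.add_apply, Matrix.diagonal_apply] <;> ring
  have hσ : ∑ k, (K k)ᵀ * spectralMatrix U l * K k = spectralMatrix 1 l' := by
    ext i j; fin_cases i <;> fin_cases j <;>
      simp [hK, hl, hl', hU, spectralMatrix, Matrix.mul_apply, Fin.sum_univ_two,
        Fin.sum_univ_three, Matrix.add_apply, Matrix.diagonal_apply] <;> ring
  set u : EuclideanSpace ℂ (Fin 2) := EuclideanSpace.single 0 1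
  have hu : ‖u‖ = 1 := by simp [u]
  have hle := h.sandwichedTrace_le_of_neg hα
    (isTracePreserving_krausMap_realOp u hu hKK)
    (realOp_spectralMatrix_mem_stateSpace hWW hp0 hps)
    (realOp_spectralMatrix_mem_stateSpace hUU hl0 hls)
    (by rw [krausMap_realOp, hρ]; exact realOp_spectralMatrix_mem_stateSpace hWW' hp0' hps')
    (by rw [krausMap_realOp, hσ]; exact realOp_spectralMatrix_mem_stateSpace h11 hl0' hls')
  rw [krausMap_realOp, krausMap_realOp, hρ, hσ] at hle
  have hin := (sandwichedTrace_realOp_mem_Icc_of_neg hUU hWW hl0 hp0 hα hα1.le).2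
  have hout := (sandwichedTrace_realOp_mem_Icc_of_neg h11 hWW' hl0' hp0' hα hα1.le).1
  have hfin := (hout.trans hle).trans hin
  generalize -((1 - α) / α) = q at hfin hlt hq
  generalize -α = b at hfin hlt hb
  have hd : ∀ i, 0 ≤ realDiag q (-1) U l W p i := fun i =>
    mul_nonneg (Real.rpow_nonneg (hl0 i).le _)
      (Finset.sum_nonneg fun j _ => mul_nonneg (Real.rpow_nonneg (hp0 j).le _) (sq_nonneg _))
  have hd' : 0 ≤ ∑ i, realDiag q (-1) 1 l' W' p' i := Finset.sum_nonneg fun i _ =>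
    mul_nonneg (Real.rpow_nonneg (hl0' i).le _)
      (Finset.sum_nonneg fun j _ => mul_nonneg (Real.rpow_nonneg (hp0' j).le _) (sq_nonneg _))
  -- Both sides blow up like `x ^ (-b)`; compare them after multiplication by `x ^ b`.
  have hmul := mul_le_mul_of_nonneg_left hfin (Real.rpow_nonneg hx0.le b)
  rw [← Real.mul_rpow hx0.le hd', Finset.mul_sum, Finset.mul_sum] at hmul
  rw [Finset.sum_congr rfl fun i _ => (Real.mul_rpow (z := b) hx0.le (hd i)).symm] at hmul
  refine absurd hmul (not_le.2 ?_)
  have hx0' : x ≠ 0 := hx0.ne'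
  have hx1' : 1 - x ≠ 0 := by linarith
  refine (Eq.trans_lt ?_ hlt).trans_eq ?_
  · have h0 : x * realDiag q (-1) U l W p 0 =
        (1 / 2) ^ q * ((24 / 25) ^ 2 + x * (2 / (1 - x) * (7 / 25) ^ 2)) := by
      simp [realDiag, Fin.sum_univ_three, hp, hl, hU, hW, dotProduct, Real.rpow_neg_one]
      field_simp
      ring
    have h1 : x * realDiag q (-1) U l W p 1 =
        (x / 2) ^ q * ((7 / 25) ^ 2 + x * (2 / (1 - x) * (24 / 25) ^ 2)) := by
      simp [realDiag, Fin.sum_univ_three, hp, hl, hU, hW, dotProduct, Real.rpow_neg_one]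
      field_simp
      ring
    have h2 : x * realDiag q (-1) U l W p 2 = ((1 - x) / 2) ^ q * (x * (2 / (1 - x))) := by
      simp [realDiag, Fin.sum_univ_three, hp, hl, hU, hW, dotProduct, Real.rpow_neg_one]
      field_simp
    rw [Fin.sum_univ_three, h0, h1, h2]
  · congr 1
    simp [realDiag, Fin.sum_univ_two, hp', hl', hW', dotProduct, Real.rpow_neg_one,
      Matrix.one_apply]
    field_simp
    ring

end Negative

/-! ### Both divergences -/

theorem mainTheorem3 :
    (∀ α : ℝ, α ∈ Set.Ioo (-1 : ℝ) 0 ∪ Set.Ioo (0 : ℝ) (1 / 2) →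
      ¬ MonotoneUnderCPTP (sandwichedDivergence α)) ∧
    (∀ α : ℝ, α ∈ Set.Ioo (0 : ℝ) (1 / 2) →
      ¬ MonotoneUnderCPTP (sandwichedRelativeEntropy α)) := by
  refine ⟨?_, fun α hα h => not_monotoneUnderCPTP_of_pos hα.1 hα.2
    (h.of_sandwichedRelativeEntropy hα.1)⟩
  rintro α (hα | hα)
  · exact not_monotoneUnderCPTP_of_neg hα.1 hα.2
  · exact not_monotoneUnderCPTP_of_pos hα.1 hα.2
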